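/- **Theorem (Liveness of Ladon).** Consider $n=3f+1$ replicas, of which at most $f$ are Byzantine (arbitrary behaviour, except that they cannot forge honest replicas' messages) and the others are honest, i.e. follow the protocol below. Honest replicas keep taking steps, are connected by reliable authenticated links, and the network is partially synchronous: there are a known bound $\Delta>0$ and an unknown time $\mathsf{GST}$ such that a message sent between honest replicas at time $s$ arrives by time $\max(s,\mathsf{GST})+\Delta$. There are $m>f$ consensus instances $0,\dots,m-1$. A *correct client* that broadcasts a transaction sends it to all replicas, and every honest replica eventually receives it. *Sequenced Broadcast.* In an instance $SB(p,R,M,D)$ only the sender $p$ broadcasts pairs $(msg,r)$, and replicas deliver pairs $(msg,r)$ with $msg\in M\cup\{\bot\}$, $r\in R$. Integrity: if an honest replica delivers $(msg,r)$ with $msg\ne\bot$ and $p$ is honest, then $p$ has broadcast $(msg,r)$. Agreement: if honest replicas deliver $(msg,r)$ and $(msg',r)$, then $msg=msg'$. Termination: every honest replica delivers, for every $r\in R$, some $(msg,r)$ with $msg\in M\cup\{\bot\}$. Moreover, $(\bot,r)$ is delivered only if the failure detector $D$ of some honest replica running round $r$ suspected $p$ of being quiet. The failure detector is eventually accurate: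 from some time on, no honest replica suspects an honest replica. *Blocks.* A block is a tuple $B=(txs,index,round,rank)$. Epoch $e$ has $l(e)\ge1$ ranks, from $minRank(e)$ to $maxRank(e)=minRank(e)+l(e)-1$, where $minRank(0)=0$ and $minRank(e+1)=maxRank(e)+1$. *Instances.* In every epoch $e$, each instance $i$ starts in view $0$ and round $1$; its leader in view $v$ is replica $(i+v)\bmod n$. Each view is run as a Sequenced Broadcast with the leader as sender, with the rounds that all honest replicas run in this view as $R$, and with the proposals that are valid in the sense below as $M$. Delivering a proposal in round $r$ *partially commits* its block, and the instance goes to round $r+1$, or stops for this epoch if the block has rank $maxRank(e)$. Delivering $\bot$ triggers a view change: round $r$ is tried again in view $v+1$. On entering a round $r\neq1$ in view $v$, each replica reports to the leader the highest rank it knows, in a signed rank message for epoch $e$, instance $i$, view $v$ and round $r-1$. Having $2f+1$ such reports from different replicas, its own included (only its own if $r=1$), the leader proposes a block with $index=i$, $round=r$, $rank=\min\{rank_m+1,maxRank(e)\}$, where $rank_m$ is the highest reported rank, together with the reports. A proposal is valid if its index, round, reports and rank obey these rules. A replica's highest known rank starts at $0$ and is raised by the blocks it partially commits and by the (verified) rank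 messages it receives; messages of future epochs are processed only once the replica is in that epoch. *Buckets.* Each transaction belongs to one of finitely many buckets, and bucket $b$ is assigned to instance $(b+e)\bmod m$ in epoch $e$. An honest leader fills a block with the oldest transactions, at most a fixed number $\geq1$ of them, that it has received, that are in the buckets of its instance, and that are in no block it has partially committed. *Global ordering.* Write $(rank,index)\prec(rank',index')$ for the lexicographic order. When a replica partially commits a block, it sets $bar=(B^*.rank+1,B^*.index)$, where $B^*$ is the $\prec$-lowest among the last partially committed blocks of the $m$ instances ($bar=(0,0)$ while some instance has no block). Then, as long as the $\prec$-lowest partially committed block that is not yet globally confirmed is $\prec bar$, it *globally confirms* that block, i.e. appends it to its global log. *Epochs.* When a replica in epoch $e$ has partially committed a block of rank $maxRank(e)$ in every instance in this epoch, and has globally confirmed all blocks it has partially committed, it sends a checkpoint message for $e$ to all replicas; once it has moreover received such messages from $2f+1$ replicas, it goes to epoch $e+1$. Then: **if a correct client broadcasts a transaction $tx$, some honest replica eventually globally confirms a block that includes $tx$**, i.e. at some later time the global log of some honest replica contains a block $B$ with $tx\in B.txs$. -/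

import Mathlib

/-! ## Sequenced Broadcast -/

/-- The observable behaviour of one Sequenced Broadcast instance `SB(p, R, M, D)` along a run whose
steps are numbered by `ℕ`; `ρ` is the type of replicas and `μ` the type of messages. -/
structure SBInstance (ρ μ : Type*) where
  /-- the only replica `p` that may broadcast -/
  sender : ρ
  /-- the set `R` of round numbers -/
  rounds : Set ℕ
  /-- the set `M` of messages allowed in a given round -/
  allowed : ℕ → Set μ
  /-- output of the failure detector `D`: at step `k`, replica `q` suspects the sender -/
  suspects : ℕ → ρ → Prop
  /-- at step `k`, replica `q` has started round `r` and has not yet delivered in it -/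
  active : ℕ → ρ → ℕ → Prop
  /-- at step `k`, the sender broadcasts `(msg, r)` -/
  broadcast : ℕ → μ → ℕ → Prop
  /-- at step `k`, replica `q` delivers `(msg, r)`; `none` is the nil value `⊥` -/
  deliver : ℕ → ρ → Option μ → ℕ → Prop

/-- The specification of Sequenced Broadcast, for the set `H` of honest replicas. -/
structure SBInstance.IsSequencedBroadcast {ρ μ : Type*} (S : SBInstance ρ μ) (H : Set ρ) :
    Prop where
  /-- Every non-nil delivered message is an allowed one. -/
  allowed_of_deliver : ∀ k, ∀ q ∈ H, ∀ msg r, S.deliver k q (some msg) r → msg ∈ S.allowed r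
  /-- SB-Integrity: if an honest replica delivers `(msg, r)` with `msg ≠ ⊥` and the sender is
  honest, then the sender has broadcast `(msg, r)`. -/
  integrity : ∀ k, ∀ q ∈ H, ∀ msg r, S.deliver k q (some msg) r → S.sender ∈ H →
    ∃ j < k, S.broadcast j msg r
  /-- SB-Agreement: two honest replicas that deliver in the same round deliver the same value. -/
  agreement : ∀ k k', ∀ q ∈ H, ∀ q' ∈ H, ∀ msg msg' r,
    S.deliver k q msg r → S.deliver k' q' msg' r → msg = msg'
  /-- SB-Termination: every honest replica delivers a (possibly nil) message for every round
  number in `R`. -/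
  termination : ∀ q ∈ H, ∀ r ∈ S.rounds, ∃ k msg, S.deliver k q msg r
  /-- Nil is delivered only if some honest replica, while running the round, suspected the
  sender of being quiet. -/
  nil_of_suspicion : ∀ k, ∀ q ∈ H, ∀ r, S.deliver k q none r →
    ∃ j ≤ k, ∃ q' ∈ H, S.active j q' r ∧ S.suspects j q'

namespace Ladon

/-! ## System parameters -/

/-- Parameters of the system, for transactions of type `Tx`. -/
structure Params (Tx : Type*) where
  /-- the maximal number of Byzantine replicas; there are `3 f + 1` replicas -/
  f : ℕ
  /-- the number of consensus instances -/
  m : ℕ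
  /-- There are more instances than faults. (The first leaders of distinct instances are
  distinct replicas, so that some instance is first led by an honest replica; without this a
  Byzantine leader of every instance could censor a transaction forever while never being
  quiet.) -/
  f_lt_m : f < m
  /-- the number `l e` of ranks in epoch `e` -/
  l : ℕ → ℕ
  l_pos : ∀ e, 0 < l e
  /-- the maximal number of transactions in a batch cut by an honest leader -/
  batchSize : ℕ
  batchSize_pos : 0 < batchSize
  /-- the number of buckets -/
  numBuckets : ℕ
  /-- the bucket of a transaction -/
  bucketOf : Tx → Fin numBuckets
  /-- the known bound on message delays after the Global Stabilization Time -/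
  Δ : ℝ
  Δ_pos : 0 < Δ

variable {Tx : Type*}

/-- The set of replicas, of size `n = 3 f + 1`. -/
abbrev Params.Replica (P : Params Tx) : Type := Fin (3 * P.f + 1)

/-- `minRank 0 = 0` and `minRank (e + 1) = maxRank e + 1`, where
`maxRank e = minRank e + l e - 1`. -/
def Params.minRank (P : Params Tx) : ℕ → ℕ
  | 0 => 0
  | e + 1 => (P.minRank e + P.l e - 1) + 1

def Params.maxRank (P : Params Tx) (e : ℕ) : ℕ := P.minRank e + P.l e - 1

/-- The leader of instance `i` in view `v`: replica `i` leads instance `i` in view `0`, and every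
view change passes the leadership on to the next replica. -/
def Params.leader (P : Params Tx) (i : Fin P.m) (v : ℕ) : P.Replica :=
  ⟨(i.val + v) % (3 * P.f + 1), Nat.mod_lt _ (Nat.succ_pos _)⟩

/-- Rotating buckets: bucket `b` is assigned to instance `(b + e) mod m` in epoch `e`. -/
def Params.InBucketSet (P : Params Tx) (e : ℕ) (i : Fin P.m) (tx : Tx) : Prop :=
  ((P.bucketOf tx).val + e) % P.m = i.val

instance (P : Params Tx) (e : ℕ) (i : Fin P.m) : DecidablePred (P.InBucketSet e i) :=
  fun _ => inferInstanceAs (Decidable (_ = _))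

/-! ## Blocks and messages -/

structure Block (P : Params Tx) where
  txs : List Tx
  index : Fin P.m
  round : ℕ
  rank : ℕ

instance [DecidableEq Tx] (P : Params Tx) : DecidableEq (Block P) := fun a b =>
  decidable_of_iff
    (a.txs = b.txs ∧ a.index = b.index ∧ a.round = b.round ∧ a.rank = b.rank) (by
    cases a; cases b; simp)

/-- The signed message `⟨RANK, v, n, ⊥, i, rank⟩`, by which `sender` reports to the leader of
view `v` of instance `i` of the given epoch, after round `n`, the highest rank it knows. -/
structure RankMsg (P : Params Tx) where
  sender : P.Replica
  epoch : ℕ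
  view : ℕ
  round : ℕ
  index : Fin P.m
  rank : ℕ

/-- What a leader broadcasts: a block together with the rank messages that justify its rank. -/
structure Proposal (P : Params Tx) where
  block : Block P
  rankSet : List (RankMsg P)

/-- One attempt to agree on the block of round `round` of instance `index` in epoch `epoch`,
under the leader of view `view`. -/
structure Slot (P : Params Tx) where
  epoch : ℕ
  index : Fin P.m
  view : ℕ
  round : ℕ

def Slot.leader {P : Params Tx} (s : Slot P) : P.Replica := P.leader s.index s.view

instance (P : Params Tx) : DecidableEq (Slot P) := fun a b =>
  decidable_of_iff
    (a.epoch = b.epoch ∧ a.index = b.index ∧ a.view = b.view ∧ a.round = b.round) (by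
    cases a; cases b; simp)

/-- `rank_m`, the highest rank in a set of rank messages. -/
def maxOfRanks {P : Params Tx} (ms : List (RankMsg P)) : ℕ :=
  (ms.map RankMsg.rank).foldr max 0

/-- The rank of the next block: `min {rank_m + 1, maxRank e}`. -/
def nextRank (P : Params Tx) (e : ℕ) (ms : List (RankMsg P)) : ℕ :=
  min (maxOfRanks ms + 1) (P.maxRank e)

/-- The proposals that replicas accept in slot `s`: the block belongs to the slot; the rank set
consists of `2 f + 1` rank messages (of one if the round is `1`) of different replicas for the
same epoch, instance and view and for the previous round; and the rank of the block is computed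
from it according to the rule. -/
structure Proposal.Valid {P : Params Tx} (s : Slot P) (p : Proposal P) : Prop where
  index_eq : p.block.index = s.index
  round_eq : p.block.round = s.round
  length_eq : p.rankSet.length = if s.round = 1 then 1 else 2 * P.f + 1
  nodup : (p.rankSet.map RankMsg.sender).Nodup
  mem : ∀ μ ∈ p.rankSet,
    μ.epoch = s.epoch ∧ μ.index = s.index ∧ μ.view = s.view ∧ μ.round = s.round - 1
  rank_eq : p.block.rank = nextRank P s.epoch p.rankSet

/-! ## The global ordering algorithm -/

/-- The order `≺` on pairs (rank, instance index). -/
def Prec (a b : ℕ × ℕ) : Prop := a.1 < b.1 ∨ (a.1 = b.1 ∧ a.2 < b.2)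

instance : DecidableRel Prec := fun a b =>
  inferInstanceAs (Decidable (a.1 < b.1 ∨ (a.1 = b.1 ∧ a.2 < b.2)))

def Block.key {P : Params Tx} (B : Block P) : ℕ × ℕ := (B.rank, B.index.val)

/-- `findLowestBlock`: start with the first block, and replace it whenever a lower one is met. -/
def findLowest {P : Params Tx} : List (Block P) → Option (Block P)
  | [] => none
  | B :: Bs => some (Bs.foldl (fun b c => if Prec c.key b.key then c else b) B)

/-- The confirmation bar `(B*.rank + 1, B*.index)`, where `B*` is the lowest among the last
partially committed blocks of the instances. As long as some instance has no block, the bar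
keeps its initial value `(0, 0)`. -/
def bar {P : Params Tx} (gin : Fin P.m → List (Block P)) : ℕ × ℕ :=
  if ∀ i, gin i ≠ [] then
    match findLowest ((List.finRange P.m).filterMap fun i => (gin i).getLast?) with
    | some B => (B.rank + 1, B.index.val)
    | none => (0, 0)
  else (0, 0)

/-- The while loop: as long as the candidate (the lowest block of `S`) is below the bar `b`,
append it to the log and remove it from `S`. The first argument bounds the number of
iterations. -/
def confirmLoop [DecidableEq Tx] {P : Params Tx} (b : ℕ × ℕ) :
    ℕ → List (Block P) → List (Block P) → List (Block P)
  | 0, _, gout => gout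
  | fuel + 1, S, gout =>
    match findLowest S with
    | none => gout
    | some B =>
      if Prec B.key b then confirmLoop b fuel (S.filter (· ≠ B)) (gout ++ [B]) else gout

/-- One run of the global ordering algorithm: from the sequences `gin` of partially committed
blocks of the instances and the global log `gout`, compute the new global log. -/
def globalOrder [DecidableEq Tx] {P : Params Tx} (gin : Fin P.m → List (Block P))
    (gout : List (Block P)) : List (Block P) :=
  let S := ((List.finRange P.m).flatMap gin).filter (· ∉ gout)
  confirmLoop (bar gin) S.length S gout

/-! ## The protocol of an honest replica -/

/-- The local state of a replica. -/
structure LState (P : Params Tx) where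
  /-- current epoch -/
  epoch : ℕ
  /-- current round of each instance of the current epoch -/
  round : Fin P.m → ℕ
  /-- current view of each instance of the current epoch -/
  view : Fin P.m → ℕ
  /-- has a block of rank `maxRank` been partially committed in the instance in this epoch? -/
  finished : Fin P.m → Bool
  /-- has this replica already proposed in the current slot of the instance? -/
  proposed : Fin P.m → Bool
  /-- the highest rank the replica knows -/
  curRank : ℕ
  /-- the sequence of partially committed blocks of each instance (over all epochs) -/
  gin : Fin P.m → List (Block P)
  /-- the global log: the globally confirmed blocks, in their global order -/
  gout : List (Block P)
  /-- the transactions received so far, oldest first -/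
  pool : List Tx
  /-- the rank messages received so far, one for each sender and slot -/
  rankMsgs : List (RankMsg P)
  /-- the checkpoint messages received so far, with their senders -/
  checkpoints : List (P.Replica × ℕ)
  /-- has the checkpoint message of the current epoch been sent? -/
  ckptSent : Bool

def LState.init (P : Params Tx) : LState P where
  epoch := 0
  round := fun _ => 1
  view := fun _ => 0
  finished := fun _ => false
  proposed := fun _ => false
  curRank := 0
  gin := fun _ => []
  gout := []
  pool := []
  rankMsgs := []
  checkpoints := []
  ckptSent := false

/-- The slot that instance `i` currently runs at a replica. -/
def LState.slot {P : Params Tx} (σ : LState P) (i : Fin P.m) : Slot P :=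
  ⟨σ.epoch, i, σ.view i, σ.round i⟩

/-- Slot `s` is currently being run. -/
def LState.Runs {P : Params Tx} (σ : LState P) (s : Slot P) : Prop :=
  σ.slot s.index = s ∧ σ.finished s.index = false

instance {P : Params Tx} (σ : LState P) (s : Slot P) : Decidable (σ.Runs s) :=
  inferInstanceAs (Decidable (_ ∧ _))

/-- What can happen at a replica. -/
inductive Input (P : Params Tx) where
  /-- a local step without input -/
  | wake
  /-- a transaction is received -/
  | recvTx (tx : Tx)
  /-- a rank message that passes verification is received (nothing is assumed about which rank
  messages of Byzantine replicas pass, i.e. about which ranks they hold certificates for) -/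
  | recvRank (μ : RankMsg P)
  /-- a checkpoint message for epoch `e` of replica `q` is received -/
  | recvCheckpoint (q : P.Replica) (e : ℕ)
  /-- Sequenced Broadcast delivers a proposal, or nil, in slot `s` -/
  | deliver (s : Slot P) (msg : Option (Proposal P))

/-- What a replica sends. -/
inductive Output (P : Params Tx) where
  /-- send a rank message to replica `dst` -/
  | rank (dst : P.Replica) (μ : RankMsg P)
  /-- send a checkpoint message for epoch `e` to all replicas -/
  | checkpoint (e : ℕ)
  /-- broadcast a proposal in the Sequenced Broadcast of slot `s` -/
  | propose (s : Slot P) (p : Proposal P)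

section Protocol

variable [DecidableEq Tx] {P : Params Tx} (self : P.Replica)

/-- The rank message of `self` for the current slot of instance `i`. -/
def ownRankMsg (σ : LState P) (i : Fin P.m) : RankMsg P :=
  ⟨self, σ.epoch, σ.view i, σ.round i - 1, i, σ.curRank⟩

/-- On entering a slot whose round is not the first one, a backup reports its highest rank to the
leader of the slot. -/
def reportRank (σ : LState P) (i : Fin P.m) : List (Output P) :=
  if σ.finished i = false ∧ σ.round i ≠ 1 ∧ (σ.slot i).leader ≠ self then
    [.rank (σ.slot i).leader (ownRankMsg self σ i)]
  else []

/-- Partial commitment of the block of the current round of instance `i`: the highest known rank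
is updated, the global ordering algorithm is run, and the instance stops for this epoch if the
block has rank `maxRank`, and goes to the next round otherwise. -/
def commit (σ : LState P) (i : Fin P.m) (B : Block P) : LState P :=
  let gin' := Function.update σ.gin i (σ.gin i ++ [B])
  { σ with
    gin := gin'
    gout := globalOrder gin' σ.gout
    curRank := max σ.curRank B.rank
    finished := Function.update σ.finished i (decide (B.rank = P.maxRank σ.epoch))
    round := Function.update σ.round i (σ.round i + 1)
    proposed := Function.update σ.proposed i false }

/-- View change of instance `i`: the current round is tried again under the next leader. -/
def viewChange (σ : LState P) (i : Fin P.m) : LState P :=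
  { σ with
    view := Function.update σ.view i (σ.view i + 1)
    proposed := Function.update σ.proposed i false }

/-- Reception of a rank message. Messages of future epochs are stored, but not yet processed. -/
def receiveRank (σ : LState P) (μ : RankMsg P) : LState P :=
  { σ with
    curRank := if μ.epoch ≤ σ.epoch then max σ.curRank μ.rank else σ.curRank
    rankMsgs :=
      if ∃ μ' ∈ σ.rankMsgs, μ'.sender = μ.sender ∧ μ'.epoch = μ.epoch ∧ μ'.index = μ.index ∧
        μ'.view = μ.view ∧ μ'.round = μ.round then σ.rankMsgs
      else σ.rankMsgs ++ [μ] }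

/-- Reaction to an input. A delivery counts only in a slot that is currently being run. -/
def handle (σ : LState P) : Input P → LState P × List (Output P)
  | .wake => (σ, [])
  | .recvTx tx => (if tx ∈ σ.pool then σ else { σ with pool := σ.pool ++ [tx] }, [])
  | .recvRank μ => (receiveRank σ μ, [])
  | .recvCheckpoint q e =>
    (if (q, e) ∈ σ.checkpoints then σ
      else { σ with checkpoints := σ.checkpoints ++ [(q, e)] }, [])
  | .deliver s msg =>
    if σ.Runs s then
      let σ' := match msg with
        | some p => commit σ s.index p.block
        | none => viewChange σ s.index
      (σ', reportRank self σ' s.index)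
    else (σ, [])

/-- All instances have reached `maxRank` of the current epoch, and all partially committed blocks
are globally confirmed. -/
def EpochDone (σ : LState P) : Prop :=
  (∀ i, σ.finished i = true) ∧ ∀ i, ∀ B ∈ σ.gin i, B ∈ σ.gout

instance (σ : LState P) : Decidable (EpochDone σ) :=
  inferInstanceAs (Decidable (_ ∧ _))

/-- At the end of the epoch, send a checkpoint message (once). -/
def sendCheckpoint (σ : LState P) : LState P × List (Output P) :=
  if EpochDone σ ∧ σ.ckptSent = false then
    ({ σ with ckptSent := true }, [.checkpoint σ.epoch])
  else (σ, [])

/-- `2 f + 1` checkpoint messages of different replicas for the current epoch. -/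
def StableCheckpoint (σ : LState P) : Prop :=
  2 * P.f + 1 ≤ (Finset.univ.filter fun q : P.Replica => (q, σ.epoch) ∈ σ.checkpoints).card

instance (σ : LState P) : Decidable (StableCheckpoint σ) :=
  inferInstanceAs (Decidable (_ ≤ _))

/-- With a stable checkpoint of the finished epoch, go to the next epoch: all instances start
afresh in view `0` and round `1`, and the stored rank messages of the new epoch are processed. -/
def advanceEpoch (σ : LState P) : LState P :=
  if EpochDone σ ∧ StableCheckpoint σ then
    { σ with
      epoch := σ.epoch + 1
      round := fun _ => 1
      view := fun _ => 0
      finished := fun _ => false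
      proposed := fun _ => false
      ckptSent := false
      curRank := max σ.curRank
        (maxOfRanks (σ.rankMsgs.filter fun μ => μ.epoch = σ.epoch + 1)) }
  else σ

/-- The rank messages of other replicas for the current slot of instance `i`. -/
def otherRankMsgs (σ : LState P) (i : Fin P.m) : List (RankMsg P) :=
  σ.rankMsgs.filter fun μ => μ.sender ≠ self ∧ μ.epoch = σ.epoch ∧ μ.index = i ∧
    μ.view = σ.view i ∧ μ.round = σ.round i - 1

/-- `cutBatch`: the oldest received transactions of the buckets of instance `i` that are in no
partially committed block. -/
def cutBatch (σ : LState P) (i : Fin P.m) : List Tx :=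
  (σ.pool.filter fun tx => P.InBucketSet σ.epoch i tx ∧ ∀ j, ∀ B ∈ σ.gin j, tx ∉ B.txs).take
    P.batchSize

/-- The leader of the current slot of instance `i` proposes once it has rank messages of `2 f + 1`
replicas, including its own; in round `1` its own is enough. -/
def CanPropose (σ : LState P) (i : Fin P.m) : Prop :=
  (σ.slot i).leader = self ∧ σ.finished i = false ∧ σ.proposed i = false ∧
    (σ.round i = 1 ∨ 2 * P.f ≤ (otherRankMsgs self σ i).length)

instance (σ : LState P) (i : Fin P.m) : Decidable (CanPropose self σ i) :=
  inferInstanceAs (Decidable (_ ∧ _))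

def makeProposal (σ : LState P) (i : Fin P.m) : Proposal P :=
  let rankSet := ownRankMsg self σ i ::
    (if σ.round i = 1 then [] else (otherRankMsgs self σ i).take (2 * P.f))
  ⟨⟨cutBatch σ i, i, σ.round i, nextRank P σ.epoch rankSet⟩, rankSet⟩

/-- In every instance where this is possible, propose; the leader's own rank message is signed
(sent to itself) as well. -/
def proposeAll (σ : LState P) : LState P × List (Output P) :=
  ({ σ with proposed := fun i => σ.proposed i || decide (CanPropose self σ i) },
    (List.finRange P.m).flatMap fun i =>
      if CanPropose self σ i then
        [.rank self (ownRankMsg self σ i), .propose (σ.slot i) (makeProposal self σ i)]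
      else [])

/-- The complete step of an honest replica on an input: its new state, and what it sends. -/
def step (σ : LState P) (inp : Input P) : LState P × List (Output P) :=
  let a := handle self σ inp
  let b := sendCheckpoint a.1
  let c := proposeAll self (advanceEpoch b.1)
  (c.1, a.2 ++ b.2 ++ c.2)

end Protocol

/-! ## Executions -/

/-- The raw data of an execution: a sequence of steps, each of which is at most one input at one
replica, with the real time at which it takes place. (Byzantine replicas show only through what
honest replicas receive and deliver.) -/
structure Execution (P : Params Tx) where
  event : ℕ → Option (P.Replica × Input P)
  clock : ℕ → ℝ
  /-- `suspects k q p`: at step `k`, the failure detector of `q` suspects `p` -/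
  suspects : ℕ → P.Replica → P.Replica → Prop
  /-- `clientBroadcast k tx`: at step `k`, a correct client broadcasts the transaction `tx` -/
  clientBroadcast : ℕ → Tx → Prop

namespace Execution

variable [DecidableEq Tx] {P : Params Tx} (x : Execution P)

/-- The state of replica `r` before step `k`. -/
def state (r : P.Replica) : ℕ → LState P
  | 0 => LState.init P
  | k + 1 =>
    match x.event k with
    | none => state r k
    | some (q, inp) => if q = r then (step r (state r k) inp).1 else state r k

/-- Replica `r` sends `o` in step `k`. -/
def Sends (k : ℕ) (r : P.Replica) (o : Output P) : Prop :=
  ∃ inp, x.event k = some (r, inp) ∧ o ∈ (step r (x.state r k) inp).2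

/-- Replica `r` delivers `msg` in slot `s` in step `k`. -/
def Delivers (k : ℕ) (r : P.Replica) (s : Slot P) (msg : Option (Proposal P)) : Prop :=
  x.event k = some (r, .deliver s msg) ∧ (x.state r k).Runs s

/-- The Sequenced Broadcast instance run in view `v` of consensus instance `i` of epoch `e`. Its
sender is the leader of the view, and its round numbers are those of the rounds that all honest
replicas run in this view. -/
def sbInstance (H : Set P.Replica) (e : ℕ) (i : Fin P.m) (v : ℕ) :
    SBInstance P.Replica (Proposal P) where
  sender := P.leader i v
  rounds := {n | ∀ q ∈ H, ∃ k, (x.state q k).Runs ⟨e, i, v, n⟩}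
  allowed := fun n => {p | p.Valid ⟨e, i, v, n⟩}
  suspects := fun k q => x.suspects k q (P.leader i v)
  active := fun k q n => (x.state q k).Runs ⟨e, i, v, n⟩
  broadcast := fun k p n => x.Sends k (P.leader i v) (.propose ⟨e, i, v, n⟩ p)
  deliver := fun k q msg n => x.Delivers k q ⟨e, i, v, n⟩ msg

/-- Time does not go back, and does not stop. -/
def ClockAdvances : Prop := Monotone x.clock ∧ Filter.Tendsto x.clock Filter.atTop Filter.atTop

/-- Honest replicas keep taking steps. -/
def HonestActive (H : Set P.Replica) : Prop :=
  ∀ r ∈ H, ∀ k, ∃ j ≥ k, x.event j = some (r, .wake)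

/-- After step `k`, and at the latest at time `max (time of k, GST) + Δ`, replica `r` has the
input `inp`. -/
def ArrivesInTime (GST : ℝ) (k : ℕ) (r : P.Replica) (inp : Input P) : Prop :=
  ∃ j > k, x.clock j ≤ max (x.clock k) GST + P.Δ ∧ x.event j = some (r, inp)

/-- Reliable links between honest replicas, with partial synchrony: there is an (unknown) Global
Stabilization Time, after which messages arrive within `Δ`. -/
def PartiallySynchronous (H : Set P.Replica) : Prop :=
  ∃ GST : ℝ, ∀ k, ∀ q ∈ H, ∀ r ∈ H,
    (∀ μ, x.Sends k q (.rank r μ) → x.ArrivesInTime GST k r (.recvRank μ)) ∧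
    (∀ e, x.Sends k q (.checkpoint e) → x.ArrivesInTime GST k r (.recvCheckpoint q e))

/-- Honest replicas' messages cannot be forged: rank messages and checkpoint messages of honest
replicas that an honest replica receives, and rank messages of honest replicas inside a proposal
that an honest replica delivers, were indeed sent before. -/
def Unforgeable (H : Set P.Replica) : Prop :=
  (∀ k, ∀ r ∈ H, ∀ μ, x.event k = some (r, .recvRank μ) → μ.sender ∈ H →
    ∃ j < k, x.Sends j μ.sender (.rank r μ)) ∧
  (∀ k, ∀ r ∈ H, ∀ q ∈ H, ∀ e, x.event k = some (r, .recvCheckpoint q e) →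
    ∃ j < k, x.Sends j q (.checkpoint e)) ∧
  (∀ k, ∀ r ∈ H, ∀ s p, x.Delivers k r s (some p) → ∀ μ ∈ p.rankSet, μ.sender ∈ H →
    ∃ j < k, ∃ dst, x.Sends j μ.sender (.rank dst μ))

/-- A transaction broadcast by a correct client is eventually received by every honest
replica. -/
def ClientLinks (H : Set P.Replica) : Prop :=
  ∀ k tx, x.clientBroadcast k tx → ∀ r ∈ H, ∃ j ≥ k, x.event j = some (r, .recvTx tx)

/-- The failure detector is eventually accurate: from some time on, no honest replica suspects an
honest replica of being quiet. -/
def EventuallyAccurate (H : Set P.Replica) : Prop :=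
  ∃ T : ℝ, ∀ k, T ≤ x.clock k → ∀ q ∈ H, ∀ p ∈ H, ¬ x.suspects k q p

/-- Executions of the protocol in which exactly the replicas in `H` are honest. -/
structure IsExecution (H : Set P.Replica) : Prop where
  clock : x.ClockAdvances
  active : x.HonestActive H
  links : x.PartiallySynchronous H
  clients : x.ClientLinks H
  unforgeable : x.Unforgeable H
  detector : x.EventuallyAccurate H
  broadcast : ∀ e i v, (x.sbInstance H e i v).IsSequencedBroadcast H

end Execution

end Ladon

/-!
The proof has two parts.

*Every honest replica passes through every epoch.* If all honest replicas run a slot, then by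
Termination and Agreement of Sequenced Broadcast they all deliver the same value in it, and so they
run the same next slot. In an instance this can go on only finitely often. A block of round
`n ≥ 2` carries the report of an honest replica, which knows the rank of the block of round
`n - 1`; hence ranks grow with rounds until `maxRank` is reached (`roundInv_and_reports`), and
rounds are bounded. Views are bounded too: the failure detector becomes accurate after finitely many
steps, and the leadership rotates, so that some view has an honest leader who is never
suspected (`exists_view_bound`). Thus all instances finish (`exists_last_block`). The last blocks
then all have rank `maxRank`, so the bar is above all blocks, and the last run of the ordering
algorithm confirms all of them (`mem_globalOrder`). All honest replicas therefore exchange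
checkpoint messages and enter the next epoch. In particular every partially committed block is
eventually globally confirmed (`exists_mem_gout`).

*Every transaction is partially committed.* The first leaders of instances `0, …, f` are
different, so one of them, `p`, is honest. There are infinitely many epochs in which its instance
has the bucket of `tx`. In such an epoch that begins after the failure detector has become
accurate, and after `p` has received `tx`, the first block of the instance is the one that `p`
proposed, and it contains `tx` or an uncommitted transaction that `p` received before `tx`
(`exists_commit`). The number of the latter is finite and decreases with every such epoch, so `tx`
itself is committed at last (`exists_mem_gin`).
-/

namespace Ladon

variable {Tx : Type*} {P : Params Tx}

/-! ### Arithmetic of leaders, buckets and ranks -/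

theorem exists_ge_add_mod_eq (a V : ℕ) {n h : ℕ} (hn : h < n) :
    ∃ v ≥ V, (a + v) % n = h := by
  refine ⟨V + (h + (n - (a + V) % n)), Nat.le_add_right _ _, ?_⟩
  have h1 := Nat.mod_add_div (a + V) n
  have h2 : (a + V) % n < n := Nat.mod_lt _ (by omega)
  have h3 : a + (V + (h + (n - (a + V) % n))) = h + n * ((a + V) / n + 1) := by
    rw [Nat.mul_add]; omega
  rw [h3, Nat.add_mul_mod_self_left, Nat.mod_eq_of_lt hn]

theorem Params.m_pos (P : Params Tx) : 0 < P.m := Nat.zero_lt_of_lt P.f_lt_m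

theorem Params.maxRank_le_succ (P : Params Tx) (e : ℕ) : P.maxRank e ≤ P.maxRank (e + 1) := by
  have := P.l_pos (e + 1)
  simp only [maxRank, minRank]
  omega

/-- The leaders of view `0` of the instances `0, …, f` are `f + 1` different replicas, so one of
them is honest. -/
theorem Params.exists_honest_first_leader (P : Params Tx) (Byz : Finset P.Replica)
    (hByz : Byz.card ≤ P.f) : ∃ i, P.leader i 0 ∉ Byz := by
  by_contra! hall
  have hm := P.f_lt_m
  have hsub : Finset.univ.image
      (fun i : Fin (P.f + 1) => P.leader ⟨i.val, by omega⟩ 0) ⊆ Byz := by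
    intro r hr
    obtain ⟨i, -, rfl⟩ := Finset.mem_image.1 hr
    exact hall _
  have hinj : Function.Injective
      (fun i : Fin (P.f + 1) => P.leader ⟨i.val, by omega⟩ 0) := by
    intro i j hij
    have h := congrArg Fin.val hij
    simp only [leader, Nat.add_zero] at h
    rw [Nat.mod_eq_of_lt (by omega), Nat.mod_eq_of_lt (by omega)] at h
    exact Fin.ext h
  have := Finset.card_le_card hsub
  rw [Finset.card_image_of_injective _ hinj, Finset.card_univ, Fintype.card_fin] at this
  omega

theorem Params.exists_honest_leader_ge (P : Params Tx) (Byz : Finset P.Replica)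
    (hByz : Byz.card ≤ P.f) (i : Fin P.m) (V : ℕ) : ∃ v ≥ V, P.leader i v ∉ Byz := by
  obtain ⟨q, hq⟩ : ∃ q, q ∉ Byz := by
    by_contra! hall
    have := Finset.card_le_card (fun q _ => hall q : Finset.univ ⊆ Byz)
    rw [Finset.card_univ, Fintype.card_fin] at this
    omega
  obtain ⟨v, hv, hmod⟩ := exists_ge_add_mod_eq i.val V q.isLt
  refine ⟨v, hv, ?_⟩
  rwa [show P.leader i v = q from Fin.ext hmod]

theorem le_maxOfRanks {ms : List (RankMsg P)} {μ : RankMsg P} (h : μ ∈ ms) :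
    μ.rank ≤ maxOfRanks ms := by
  induction ms with
  | nil => simp at h
  | cons a l ih =>
    simp only [maxOfRanks, List.map_cons, List.foldr_cons] at ih ⊢
    rcases List.mem_cons.1 h with rfl | h
    · exact le_max_left _ _
    · exact (ih h).trans (le_max_right _ _)

theorem Proposal.Valid.rank_le {s : Slot P} {p : Proposal P} (h : p.Valid s) :
    p.block.rank ≤ P.maxRank s.epoch := by
  rw [h.rank_eq]; exact min_le_right _ _

/-- `2 f + 1` rank messages of different replicas include one of an honest replica. -/
theorem Proposal.Valid.exists_honest_report {s : Slot P} {p : Proposal P} (h : p.Valid s)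
    (hs : s.round ≠ 1) {Byz : Finset P.Replica} (hByz : Byz.card ≤ P.f) :
    ∃ μ ∈ p.rankSet, μ.sender ∉ Byz := by
  by_contra! hall
  have hsub : (p.rankSet.map RankMsg.sender).toFinset ⊆ Byz := by
    intro q hq
    obtain ⟨μ, hμ, rfl⟩ := List.mem_map.1 (List.mem_toFinset.1 hq)
    exact hall μ hμ
  have := Finset.card_le_card hsub
  rw [List.toFinset_card_of_nodup h.nodup, List.length_map, h.length_eq, if_neg hs] at this
  omega

/-- The report of an honest replica inside a delivered proposal shows that the rank of the block
is at least its round minus one, unless it is the maximal rank of the epoch. -/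
theorem Proposal.Valid.round_le_rank {s : Slot P} {p : Proposal P} (hp : p.Valid s)
    {Byz : Finset P.Replica} (hByz : Byz.card ≤ P.f)
    (hreport : ∀ μ ∈ p.rankSet, μ.sender ∉ Byz → μ.round + 1 ≤ μ.rank + 2)
    (hne : p.block.rank ≠ P.maxRank s.epoch) : s.round ≤ p.block.rank + 1 := by
  by_cases h1 : s.round = 1
  · omega
  obtain ⟨μ, hμ, hs⟩ := hp.exists_honest_report h1 hByz
  have h2 := hreport μ hμ hs
  have h3 := (hp.mem μ hμ).2.2.2
  have h4 := le_maxOfRanks hμ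
  have h5 := hp.rank_eq
  simp only [nextRank] at h5
  omega

/-! ### Order and invariants of local states -/

/-- `τ` is a possible later state of a replica in state `σ`, as far as the data are concerned that
never shrink. Instances stay finished only as long as the epoch lasts. -/
structure LState.Extends (σ τ : LState P) : Prop where
  epoch : σ.epoch ≤ τ.epoch
  gin : ∀ i, σ.gin i ⊆ τ.gin i
  gout : σ.gout ⊆ τ.gout
  pool : σ.pool <+: τ.pool
  checkpoints : σ.checkpoints ⊆ τ.checkpoints
  finished : σ.epoch = τ.epoch → ∀ i, σ.finished i = true → τ.finished i = true

theorem LState.Extends.refl (σ : LState P) : σ.Extends σ :=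
  ⟨le_rfl, fun _ => List.Subset.refl _, List.Subset.refl _, List.prefix_refl _,
    List.Subset.refl _, fun _ _ h => h⟩

theorem LState.Extends.trans {σ τ ρ : LState P} (h : σ.Extends τ) (h' : τ.Extends ρ) :
    σ.Extends ρ where
  epoch := h.epoch.trans h'.epoch
  gin i := List.Subset.trans (h.gin i) (h'.gin i)
  gout := List.Subset.trans h.gout h'.gout
  pool := h.pool.trans h'.pool
  checkpoints := List.Subset.trans h.checkpoints h'.checkpoints
  finished e i hi := by
    have h1 := h.epoch
    have h2 := h'.epoch
    exact h'.finished (by omega) i (h.finished (by omega) i hi)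

/-- Rounds do not outrun ranks: before the last round of the epoch, the highest known rank grows
with every round, so that the number of rounds is bounded. -/
def LState.RoundInv (σ : LState P) : Prop :=
  ∀ i, σ.finished i = false →
    σ.round i ≤ σ.curRank + 2 ∧ σ.round i ≤ P.maxRank σ.epoch + 1

/-- Blocks have ranks of the current or an earlier epoch, a finished instance ends with a block of
the maximal rank, and once all instances are finished, everything is globally confirmed. -/
structure LState.LogInv (σ : LState P) : Prop where
  rank_le : ∀ i, ∀ B ∈ σ.gin i, B.rank ≤ P.maxRank σ.epoch
  last : ∀ i, σ.finished i = true →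
    ∃ B, (σ.gin i).getLast? = some B ∧ B.rank = P.maxRank σ.epoch
  confirmed : (∀ i, σ.finished i = true) → ∀ i, ∀ B ∈ σ.gin i, B ∈ σ.gout

theorem not_epochDone_of_finished_eq_false {σ : LState P} {i : Fin P.m}
    (h : σ.finished i = false) : ¬ EpochDone σ := fun hd => by
  simp [hd.1 i] at h

theorem LState.LogInv.epochDone {σ : LState P} (h : σ.LogInv)
    (hf : ∀ i, σ.finished i = true) : EpochDone σ :=
  ⟨hf, h.confirmed hf⟩

/-- All instances are in the first round under their first leader. -/
def LState.Fresh (σ : LState P) : Prop :=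
  ∀ i, σ.Runs ⟨σ.epoch, i, 0, 1⟩

theorem LState.init_fresh : (LState.init P).Fresh := fun _ => ⟨rfl, rfl⟩

theorem LState.Fresh.not_epochDone {σ : LState P} (h : σ.Fresh) : ¬ EpochDone σ :=
  not_epochDone_of_finished_eq_false (h ⟨0, P.m_pos⟩).2

theorem rank_mem_reportRank {self dst : P.Replica} {σ : LState P} {i : Fin P.m}
    {μ : RankMsg P} (h : Output.rank dst μ ∈ reportRank self σ i) :
    σ.finished i = false ∧ μ = ownRankMsg self σ i := by
  rw [reportRank] at h
  split at h
  · next h' =>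
    simp only [List.mem_singleton, Output.rank.injEq] at h
    exact ⟨h'.1, h.2⟩
  · simp at h

/-! ### The global ordering algorithm -/

theorem findLowest_mem {l : List (Block P)} {B : Block P} (h : findLowest l = some B) :
    B ∈ l := by
  have key : ∀ (l : List (Block P)) (A : Block P),
      l.foldl (fun b c => if Prec c.key b.key then c else b) A ∈ A :: l := by
    intro l
    induction l with
    | nil => intro A; simp
    | cons c l ih =>
      intro A
      rw [List.foldl_cons]
      split
      · exact List.mem_cons_of_mem _ (ih c)
      · rcases List.mem_cons.1 (ih A) with h | h
        · rw [h]; exact List.mem_cons_self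
        · exact List.mem_cons_of_mem _ (List.mem_cons_of_mem _ h)
  cases l with
  | nil => simp [findLowest] at h
  | cons A l =>
    simp only [findLowest, Option.some.injEq] at h
    exact h ▸ key l A

variable [DecidableEq Tx]

theorem subset_confirmLoop (b : ℕ × ℕ) (fuel : ℕ) (S gout : List (Block P)) :
    gout ⊆ confirmLoop b fuel S gout := by
  induction fuel generalizing S gout with
  | zero => exact List.Subset.refl _
  | succ n ih =>
    rw [confirmLoop]
    split
    · exact List.Subset.refl _
    · split
      · exact List.Subset.trans (List.subset_append_left _ _) (ih _ _)
      · exact List.Subset.refl _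

theorem subset_globalOrder (gin : Fin P.m → List (Block P)) (gout : List (Block P)) :
    gout ⊆ globalOrder gin gout :=
  subset_confirmLoop _ _ _ _

/-- If all candidates are below the bar, the loop confirms all of them. -/
theorem mem_confirmLoop {b : ℕ × ℕ} {fuel : ℕ} {S gout : List (Block P)}
    (hfuel : S.length ≤ fuel) (hS : ∀ B ∈ S, Prec B.key b) {B : Block P} (hB : B ∈ S) :
    B ∈ confirmLoop b fuel S gout := by
  induction fuel generalizing S gout with
  | zero =>
    rw [List.length_eq_zero_iff.1 (Nat.le_zero.1 hfuel)] at hB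
    simp at hB
  | succ n ih =>
    rw [confirmLoop]
    cases hA : findLowest S with
    | none => cases S <;> simp [findLowest] at hA hB
    | some A =>
      have hAS := findLowest_mem hA
      simp only [if_pos (hS A hAS)]
      by_cases hBA : B = A
      · exact subset_confirmLoop _ _ _ _ (by simp [hBA])
      · refine ih ?_ (fun C hC => hS C (List.mem_filter.1 hC).1)
          (List.mem_filter.2 ⟨hB, by simpa using hBA⟩)
        have := (List.length_filter_lt_length_iff_exists (p := fun C => decide (C ≠ A))).2
          ⟨A, hAS, by simp⟩
        omega

/-- If the last blocks of all instances have rank `R`, and no block has a higher rank, then the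
bar is at rank `R + 1`, and all partially committed blocks are globally confirmed. -/
theorem mem_globalOrder {gin : Fin P.m → List (Block P)} {gout : List (Block P)} {R : ℕ}
    (hle : ∀ i, ∀ B ∈ gin i, B.rank ≤ R)
    (hlast : ∀ i, ∃ B, (gin i).getLast? = some B ∧ B.rank = R)
    {i : Fin P.m} {B : Block P} (hB : B ∈ gin i) : B ∈ globalOrder gin gout := by
  by_cases hout : B ∈ gout
  · exact subset_globalOrder gin gout hout
  have hbar : (bar gin).1 = R + 1 := by
    have hne : ∀ i, gin i ≠ [] := by
      intro j hj
      obtain ⟨C, hC, -⟩ := hlast j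
      simp [hj] at hC
    rw [bar, if_pos hne]
    cases hl : findLowest ((List.finRange P.m).filterMap fun i => (gin i).getLast?) with
    | none =>
      exfalso
      obtain ⟨C, hC, -⟩ := hlast i
      have : C ∈ (List.finRange P.m).filterMap fun i => (gin i).getLast? :=
        List.mem_filterMap.2 ⟨i, List.mem_finRange i, hC⟩
      revert hl
      generalize (List.finRange P.m).filterMap (fun i => (gin i).getLast?) = L at this
      cases L <;> simp [findLowest] at this ⊢
    | some C =>
      obtain ⟨j, -, hj⟩ := List.mem_filterMap.1 (findLowest_mem hl)
      obtain ⟨C', hC', hR⟩ := hlast j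
      rw [hj, Option.some.injEq] at hC'
      simp [hC', hR]
  refine mem_confirmLoop le_rfl (fun C hC => Or.inl ?_) ?_
  · obtain ⟨j, -, hj⟩ := List.mem_flatMap.1 (List.mem_filter.1 hC).1
    have := hle j C hj
    simp only [Block.key, hbar]
    omega
  · exact List.mem_filter.2
      ⟨List.mem_flatMap.2 ⟨i, List.mem_finRange i, hB⟩, by simpa using hout⟩

/-! ### The step of an honest replica -/

/-- An input either commits a block, or changes a view, or only adds to what the replica has
received. -/
theorem handle_cases (self : P.Replica) (σ : LState P) (inp : Input P) :
    (∃ s p, inp = .deliver s (some p) ∧ σ.Runs s ∧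
      (handle self σ inp).1 = commit σ s.index p.block) ∨
    (∃ s, inp = .deliver s none ∧ σ.Runs s ∧
      (handle self σ inp).1 = viewChange σ s.index) ∨
    ∃ cr pool rm ck, σ.curRank ≤ cr ∧ σ.pool <+: pool ∧ σ.checkpoints ⊆ ck ∧
      (handle self σ inp).1 =
        { σ with curRank := cr, pool := pool, rankMsgs := rm, checkpoints := ck } := by
  have same : ∃ cr pool rm ck, σ.curRank ≤ cr ∧ σ.pool <+: pool ∧ σ.checkpoints ⊆ ck ∧
      σ = { σ with curRank := cr, pool := pool, rankMsgs := rm, checkpoints := ck } :=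
    ⟨σ.curRank, σ.pool, σ.rankMsgs, σ.checkpoints, le_rfl, List.prefix_refl _,
      List.Subset.refl _, rfl⟩
  cases inp with
  | wake => exact Or.inr (Or.inr same)
  | recvTx tx =>
    refine Or.inr (Or.inr ?_)
    by_cases h : tx ∈ σ.pool
    · simpa [handle, h] using same
    · exact ⟨σ.curRank, σ.pool ++ [tx], σ.rankMsgs, σ.checkpoints, le_rfl,
        List.prefix_append _ _, List.Subset.refl _, by simp [handle, h]⟩
  | recvRank μ =>
    refine Or.inr (Or.inr ⟨_, σ.pool, _, σ.checkpoints, ?_, List.prefix_refl _,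
      List.Subset.refl _, rfl⟩)
    split
    · exact le_max_left _ _
    · exact le_rfl
  | recvCheckpoint q e =>
    refine Or.inr (Or.inr ?_)
    by_cases h : (q, e) ∈ σ.checkpoints
    · simpa [handle, h] using same
    · exact ⟨σ.curRank, σ.pool, σ.rankMsgs, σ.checkpoints ++ [(q, e)], le_rfl,
        List.prefix_refl _, List.subset_append_left _ _, by simp [handle, h]⟩
  | deliver s msg =>
    by_cases h : σ.Runs s
    · cases msg with
      | none => exact Or.inr (Or.inl ⟨s, rfl, h, by simp [handle, h]⟩)
      | some p => exact Or.inl ⟨s, p, rfl, h, by simp [handle, h]⟩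
    · exact Or.inr (Or.inr (by simpa [handle, h] using same))

/-- After the reaction to the input, a step either goes to the next epoch, or changes nothing but
the records of what has been sent. -/
theorem step_cases (self : P.Replica) (σ : LState P) (inp : Input P) :
    (EpochDone (handle self σ inp).1 ∧
      ∃ prop cr, (handle self σ inp).1.curRank ≤ cr ∧
        (step self σ inp).1 =
          { (handle self σ inp).1 with
            epoch := (handle self σ inp).1.epoch + 1
            round := fun _ => 1
            view := fun _ => 0
            finished := fun _ => false
            proposed := prop
            ckptSent := false
            curRank := cr }) ∨
    (¬ (EpochDone (handle self σ inp).1 ∧ StableCheckpoint (handle self σ inp).1) ∧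
      ∃ prop sent, (EpochDone (handle self σ inp).1 → sent = true) ∧
        (sent = true → EpochDone (handle self σ inp).1 ∨
          (handle self σ inp).1.ckptSent = true) ∧
        (step self σ inp).1 =
          { (handle self σ inp).1 with proposed := prop, ckptSent := sent }) := by
  rw [step]
  generalize (handle self σ inp).1 = τ
  obtain ⟨c, hc1, hc2, hc⟩ : ∃ c, (EpochDone τ → c = true) ∧
      (c = true → EpochDone τ ∨ τ.ckptSent = true) ∧
      (sendCheckpoint τ).1 = { τ with ckptSent := c } := by
    rw [sendCheckpoint]
    split
    · next h => exact ⟨true, fun _ => rfl, fun _ => Or.inl h.1, rfl⟩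
    · next h =>
      refine ⟨τ.ckptSent, fun hd => ?_, Or.inr, rfl⟩
      by_contra hn
      exact h ⟨hd, by simpa using hn⟩
  simp only [hc]
  by_cases h : EpochDone τ ∧ StableCheckpoint τ
  · refine Or.inl ⟨h.1, ?_⟩
    rw [advanceEpoch, if_pos (show EpochDone { τ with ckptSent := c } ∧
      StableCheckpoint { τ with ckptSent := c } from h)]
    exact ⟨_, _, le_max_left _ _, rfl⟩
  · refine Or.inr ⟨h, ?_⟩
    rw [advanceEpoch, if_neg (show ¬ (EpochDone { τ with ckptSent := c } ∧
      StableCheckpoint { τ with ckptSent := c }) from h)]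
    exact ⟨_, c, hc1, hc2, rfl⟩

theorem handle_epoch (self : P.Replica) (σ : LState P) (inp : Input P) :
    (handle self σ inp).1.epoch = σ.epoch := by
  obtain ⟨s, p, -, -, h⟩ | ⟨s, -, -, h⟩ | ⟨_, _, _, _, -, -, -, h⟩ := handle_cases self σ inp <;>
    rw [h] <;> rfl

theorem handle_ckptSent (self : P.Replica) (σ : LState P) (inp : Input P) :
    (handle self σ inp).1.ckptSent = σ.ckptSent := by
  obtain ⟨s, p, -, -, h⟩ | ⟨s, -, -, h⟩ | ⟨_, _, _, _, -, -, -, h⟩ := handle_cases self σ inp <;>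
    rw [h] <;> rfl

theorem handle_extends (self : P.Replica) (σ : LState P) (inp : Input P) :
    σ.Extends (handle self σ inp).1 := by
  obtain ⟨s, p, -, hs, h⟩ | ⟨s, -, hs, h⟩ | ⟨cr, pool, rm, ck, -, hp, hc, h⟩ :=
    handle_cases self σ inp <;> rw [h]
  · refine ⟨le_rfl, fun i => ?_, subset_globalOrder _ _, List.prefix_refl _,
      List.Subset.refl _, fun _ i hi => ?_⟩
    · by_cases hi : i = s.index
      · subst hi; simp [commit]
      · simp [commit, hi]
    · have : i ≠ s.index := by
        rintro rfl
        simp [hs.2] at hi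
      simpa [commit, this] using hi
  · exact ⟨le_rfl, fun _ => List.Subset.refl _, List.Subset.refl _, List.prefix_refl _,
      List.Subset.refl _, fun _ _ h => h⟩
  · exact ⟨le_rfl, fun _ => List.Subset.refl _, List.Subset.refl _, hp, hc, fun _ _ h => h⟩

theorem handle_extends_step (self : P.Replica) (σ : LState P) (inp : Input P) :
    (handle self σ inp).1.Extends (step self σ inp).1 := by
  obtain ⟨-, _, _, -, h⟩ | ⟨-, _, _, -, -, h⟩ := step_cases self σ inp <;> rw [h]
  · exact ⟨Nat.le_succ _, fun _ => List.Subset.refl _, List.Subset.refl _, List.prefix_refl _,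
      List.Subset.refl _, fun e => absurd e (Nat.succ_ne_self _).symm⟩
  · exact ⟨le_rfl, fun _ => List.Subset.refl _, List.Subset.refl _, List.prefix_refl _,
      List.Subset.refl _, fun _ _ h => h⟩

theorem step_extends (self : P.Replica) (σ : LState P) (inp : Input P) :
    σ.Extends (step self σ inp).1 :=
  (handle_extends self σ inp).trans (handle_extends_step self σ inp)

theorem mem_pool_step (self : P.Replica) (σ : LState P) (tx : Tx) :
    tx ∈ (step self σ (.recvTx tx)).1.pool := by
  refine (handle_extends_step self σ _).pool.subset ?_
  by_cases h : tx ∈ σ.pool <;> simp [handle, h]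

theorem mem_checkpoints_step (self : P.Replica) (σ : LState P) (q : P.Replica) (e : ℕ) :
    (q, e) ∈ (step self σ (.recvCheckpoint q e)).1.checkpoints := by
  refine (handle_extends_step self σ _).checkpoints ?_
  by_cases h : (q, e) ∈ σ.checkpoints <;> simp [handle, h]

theorem Output.checkpoint_mem_step {self : P.Replica} {σ : LState P} {inp : Input P}
    (hd : EpochDone (handle self σ inp).1) (hs : σ.ckptSent = false) :
    Output.checkpoint σ.epoch ∈ (step self σ inp).2 := by
  rw [← handle_ckptSent self σ inp] at hs
  simp only [step, List.mem_append, sendCheckpoint, hd, hs, and_self, if_true, handle_epoch,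
    List.mem_singleton, true_or, or_true]

/-- A rank message is sent for an unfinished instance, and reports the rank known after the
reaction to the input, or at the end of the step. -/
theorem Output.rank_mem_step {self dst : P.Replica} {σ : LState P} {inp : Input P}
    {μ : RankMsg P} (h : Output.rank dst μ ∈ (step self σ inp).2) :
    ∃ τ i, (τ = (handle self σ inp).1 ∨ τ = (step self σ inp).1) ∧ τ.finished i = false ∧
      μ = ownRankMsg self τ i := by
  rcases List.mem_append.1 h with h | h
  · rcases List.mem_append.1 h with h | h
    · cases inp with
      | deliver s msg =>
        refine ⟨_, s.index, Or.inl rfl, ?_⟩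
        by_cases hs : σ.Runs s
        · simp only [handle, if_pos hs] at h ⊢
          exact rank_mem_reportRank h
        · simp [handle, hs] at h
      | _ => simp [handle] at h
    · simp only [sendCheckpoint] at h
      split at h <;> simp at h
  · obtain ⟨i, -, hi⟩ := List.mem_flatMap.1 h
    split at hi
    · next hc =>
      simp only [List.mem_cons, Output.rank.injEq, List.not_mem_nil, or_false,
        reduceCtorEq] at hi
      exact ⟨_, i, Or.inr rfl, hc.2.1, hi.2⟩
    · simp at hi

/-- What a replica proposes is a batch cut in the state at the end of the step. -/
theorem Output.propose_mem_step {self : P.Replica} {σ : LState P} {inp : Input P}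
    {s : Slot P} {p : Proposal P} (h : Output.propose s p ∈ (step self σ inp).2) :
    s = (step self σ inp).1.slot s.index ∧
      p.block.txs = cutBatch (step self σ inp).1 s.index := by
  rcases List.mem_append.1 h with h | h
  · exfalso
    rcases List.mem_append.1 h with h | h
    · cases inp with
      | deliver s msg =>
        by_cases hs : σ.Runs s
        · simp only [handle, if_pos hs, reportRank] at h
          split at h <;> simp at h
        · simp [handle, hs] at h
      | _ => simp [handle] at h
    · simp only [sendCheckpoint] at h
      split at h <;> simp at h
  · obtain ⟨i, -, hi⟩ := List.mem_flatMap.1 h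
    split at hi
    · simp only [List.mem_cons, Output.propose.injEq, List.not_mem_nil, or_false, false_or,
        reduceCtorEq] at hi
      obtain ⟨rfl, rfl⟩ := hi
      exact ⟨rfl, rfl⟩
    · simp at hi

/-! ### Preservation of the invariants, and effects of deliveries -/

theorem handle_roundInv {self : P.Replica} {σ : LState P} {inp : Input P} (hσ : σ.RoundInv)
    (hv : ∀ s p, inp = .deliver s (some p) → σ.Runs s → p.block.rank ≤ P.maxRank s.epoch ∧
      (p.block.rank ≠ P.maxRank s.epoch → s.round ≤ p.block.rank + 1)) :
    (handle self σ inp).1.RoundInv := by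
  obtain ⟨s, p, hi, hs, h⟩ | ⟨s, -, hs, h⟩ | ⟨cr, pool, rm, ck, hcr, -, -, h⟩ :=
    handle_cases self σ inp <;> rw [h] <;> intro i hf
  · obtain ⟨h1, h2⟩ := hv s p hi hs
    have he : σ.epoch = s.epoch := congrArg Slot.epoch hs.1
    have hr : σ.round s.index = s.round := congrArg Slot.round hs.1
    by_cases his : i = s.index
    · subst his
      simp only [commit, Function.update_self, decide_eq_false_iff_not] at hf ⊢
      rw [he] at hf ⊢
      have := h2 hf
      omega
    · simp only [commit, ne_eq, his, not_false_eq_true, Function.update_of_ne] at hf ⊢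
      have := hσ i hf
      omega
  · exact hσ i hf
  · have := hσ i hf
    exact ⟨this.1.trans (by simpa using hcr), this.2⟩

theorem step_roundInv {self : P.Replica} {σ : LState P} {inp : Input P}
    (h : (handle self σ inp).1.RoundInv) : (step self σ inp).1.RoundInv := by
  obtain ⟨-, _, _, hcr, heq⟩ | ⟨-, _, _, -, -, heq⟩ := step_cases self σ inp <;> rw [heq]
  · intro i _
    constructor <;> simp
  · exact h

theorem handle_logInv {self : P.Replica} {σ : LState P} {inp : Input P} (hσ : σ.LogInv)
    (hv : ∀ s p, inp = .deliver s (some p) → σ.Runs s → p.block.rank ≤ P.maxRank s.epoch) :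
    (handle self σ inp).1.LogInv := by
  obtain ⟨s, p, hi, hs, h⟩ | ⟨s, -, hs, h⟩ | ⟨cr, pool, rm, ck, hcr, -, -, h⟩ :=
    handle_cases self σ inp <;> rw [h]
  · have hr := hv s p hi hs
    rw [← show σ.epoch = s.epoch from congrArg Slot.epoch hs.1] at hr
    have h1 : ∀ i, ∀ B ∈ (commit σ s.index p.block).gin i, B.rank ≤ P.maxRank σ.epoch := by
      intro i B hB
      by_cases his : i = s.index
      · subst his
        simp only [commit, Function.update_self, List.mem_append, List.mem_singleton] at hB
        rcases hB with hB | rfl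
        · exact hσ.rank_le _ B hB
        · exact hr
      · simp only [commit, ne_eq, his, not_false_eq_true, Function.update_of_ne] at hB
        exact hσ.rank_le i B hB
    have h2 : ∀ i, (commit σ s.index p.block).finished i = true →
        ∃ B, ((commit σ s.index p.block).gin i).getLast? = some B ∧
          B.rank = P.maxRank σ.epoch := by
      intro i hf
      by_cases his : i = s.index
      · subst his
        simp only [commit, Function.update_self, decide_eq_true_eq] at hf ⊢
        exact ⟨p.block, by simp, hf⟩
      · simp only [commit, ne_eq, his, not_false_eq_true, Function.update_of_ne] at hf ⊢
        exact hσ.last i hf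
    exact ⟨h1, h2, fun hf i B hB => mem_globalOrder h1 (fun j => h2 j (hf j)) hB⟩
  · exact ⟨hσ.rank_le, hσ.last, hσ.confirmed⟩
  · exact ⟨hσ.rank_le, hσ.last, hσ.confirmed⟩

theorem step_logInv {self : P.Replica} {σ : LState P} {inp : Input P}
    (h : (handle self σ inp).1.LogInv) : (step self σ inp).1.LogInv := by
  obtain ⟨-, _, _, hcr, heq⟩ | ⟨-, _, _, -, -, heq⟩ := step_cases self σ inp <;> rw [heq]
  · refine ⟨fun i B hB => (h.rank_le i B hB).trans (P.maxRank_le_succ _), ?_, ?_⟩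
    · intro i hf
      simp at hf
    · intro hf
      simpa using hf ⟨0, P.m_pos⟩
  · exact ⟨h.rank_le, h.last, h.confirmed⟩

/-- A step in which the epoch changes goes to the next epoch, from a state in which the blocks of
the old one are all globally confirmed. -/
theorem step_of_epoch_ne {self : P.Replica} {σ : LState P} {inp : Input P}
    (h : (step self σ inp).1.epoch ≠ σ.epoch) :
    (step self σ inp).1.epoch = σ.epoch + 1 ∧ (step self σ inp).1.Fresh ∧
      EpochDone (handle self σ inp).1 ∧
      ∀ i, ∀ B ∈ (step self σ inp).1.gin i, B ∈ (step self σ inp).1.gout := by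
  obtain ⟨hd, _, _, hcr, heq⟩ | ⟨-, _, _, -, -, heq⟩ := step_cases self σ inp
  · rw [heq]
    exact ⟨by simp [handle_epoch], fun i => ⟨rfl, rfl⟩, hd, hd.2⟩
  · rw [heq] at h
    exact absurd (handle_epoch self σ inp) h

/-- A delivery that leaves the instance unfinished has its usual effect, since the epoch cannot
end in this step. -/
theorem step_runs_of_nil {self : P.Replica} {σ : LState P} {s : Slot P} (hs : σ.Runs s) :
    (step self σ (.deliver s none)).1.Runs ⟨s.epoch, s.index, s.view + 1, s.round⟩ := by
  have hτ : (handle self σ (.deliver s none)).1 = viewChange σ s.index := by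
    simp [handle, hs]
  have hr : (viewChange σ s.index).Runs ⟨s.epoch, s.index, s.view + 1, s.round⟩ := by
    refine ⟨?_, hs.2⟩
    have h1 := congrArg Slot.epoch hs.1
    have h2 := congrArg Slot.view hs.1
    have h3 := congrArg Slot.round hs.1
    simp only [LState.slot] at h1 h2 h3
    simp [LState.slot, viewChange, h1, h2, h3]
  obtain ⟨hd, -⟩ | ⟨-, _, _, -, -, heq⟩ := step_cases self σ (.deliver s none)
  · rw [hτ] at hd
    exact absurd hd (not_epochDone_of_finished_eq_false hr.2)
  · rw [heq, hτ]
    exact hr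

theorem step_runs_of_commit {self : P.Replica} {σ : LState P} {s : Slot P} {p : Proposal P}
    (hs : σ.Runs s) (hp : p.block.rank ≠ P.maxRank s.epoch) :
    (step self σ (.deliver s (some p))).1.Runs
      ⟨s.epoch, s.index, s.view, s.round + 1⟩ := by
  have hτ : (handle self σ (.deliver s (some p))).1 = commit σ s.index p.block := by
    simp [handle, hs]
  have hr : (commit σ s.index p.block).Runs ⟨s.epoch, s.index, s.view, s.round + 1⟩ := by
    have h1 := congrArg Slot.epoch hs.1
    have h2 := congrArg Slot.view hs.1
    have h3 := congrArg Slot.round hs.1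
    simp only [LState.slot] at h1 h2 h3
    exact ⟨by simp [LState.slot, commit, h1, h2, h3], by simp [commit, h1, hp]⟩
  obtain ⟨hd, -⟩ | ⟨-, _, _, -, -, heq⟩ := step_cases self σ (.deliver s (some p))
  · rw [hτ] at hd
    exact absurd hd (not_epochDone_of_finished_eq_false hr.2)
  · rw [heq, hτ]
    exact hr

theorem step_mem_gin_of_commit {self : P.Replica} {σ : LState P} {s : Slot P} {p : Proposal P}
    (hs : σ.Runs s) : p.block ∈ (step self σ (.deliver s (some p))).1.gin s.index := by
  refine (handle_extends_step self σ _).gin _ ?_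
  simp [handle, hs, commit]

theorem step_finished_of_commit {self : P.Replica} {σ : LState P} {s : Slot P}
    {p : Proposal P} (hs : σ.Runs s) (hp : p.block.rank = P.maxRank s.epoch)
    (he : (step self σ (.deliver s (some p))).1.epoch = s.epoch) :
    (step self σ (.deliver s (some p))).1.finished s.index = true := by
  have h1 : σ.epoch = s.epoch := congrArg Slot.epoch hs.1
  refine (handle_extends_step self σ _).finished ?_ _ ?_
  · rw [handle_epoch, he, h1]
  · simp [handle, hs, commit, hp, h1]

theorem exists_mem_take_filter {α : Type*} {q : α → Bool} {a : α} (ha : q a = true)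
    (pre post : List α) {b : ℕ} (hb : 0 < b) :
    ∃ t ∈ ((pre ++ a :: post).filter q).take b, (t ∈ pre ∨ t = a) ∧ q t = true := by
  obtain ⟨c, rfl⟩ := Nat.exists_eq_succ_of_ne_zero hb.ne'
  rw [List.filter_append, List.filter_cons_of_pos ha]
  cases hpre : pre.filter q with
  | nil => exact ⟨a, by simp, Or.inr rfl, ha⟩
  | cons t l =>
    have ht := List.mem_filter.1 (hpre ▸ List.mem_cons_self : t ∈ pre.filter q)
    exact ⟨t, by simp, Or.inl ht.1, ht.2⟩

/-- The batch of a leader that has received `tx`, and has not committed it, contains `tx` or a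
transaction that arrived before `tx`. -/
theorem exists_mem_cutBatch {σ : LState P} {i : Fin P.m} {tx : Tx} {pre post : List Tx}
    (hpool : σ.pool = pre ++ tx :: post) (hb : P.InBucketSet σ.epoch i tx)
    (hnew : ∀ j, ∀ B ∈ σ.gin j, tx ∉ B.txs) :
    ∃ t ∈ cutBatch σ i, (t ∈ pre ∨ t = tx) ∧ ∀ j, ∀ B ∈ σ.gin j, t ∉ B.txs := by
  rw [cutBatch, hpool]
  obtain ⟨t, ht, h, hq⟩ := exists_mem_take_filter
    (q := fun tx => decide (P.InBucketSet σ.epoch i tx ∧ ∀ j, ∀ B ∈ σ.gin j, tx ∉ B.txs))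
    (decide_eq_true ⟨hb, hnew⟩) pre post P.batchSize_pos
  exact ⟨t, ht, h, (of_decide_eq_true hq).2⟩

/-! ### Runs of honest replicas -/

namespace Execution

variable {x : Execution P}

theorem state_succ_of_event {k : ℕ} {r : P.Replica} {inp : Input P}
    (h : x.event k = some (r, inp)) :
    x.state r (k + 1) = (step r (x.state r k) inp).1 := by
  simp [state, h]

theorem state_succ_cases (x : Execution P) (k : ℕ) (r : P.Replica) :
    x.state r (k + 1) = x.state r k ∨ ∃ inp, x.event k = some (r, inp) ∧
      x.state r (k + 1) = (step r (x.state r k) inp).1 := by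
  match h : x.event k with
  | none => left; simp [state, h]
  | some (q, inp) =>
    by_cases hq : q = r
    · subst hq
      exact Or.inr ⟨inp, rfl, state_succ_of_event h⟩
    · left; simp [state, h, hq]

theorem state_extends (x : Execution P) (r : P.Replica) {k k' : ℕ} (h : k ≤ k') :
    (x.state r k).Extends (x.state r k') := by
  induction k', h using Nat.le_induction with
  | base => exact .refl _
  | succ j _ ih =>
    refine ih.trans ?_
    obtain h | ⟨inp, -, h⟩ := x.state_succ_cases j r <;> rw [h]
    · exact .refl _
    · exact step_extends _ _ _

theorem lt_of_epoch_lt {r : P.Replica} {k j : ℕ}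
    (h : (x.state r k).epoch < (x.state r j).epoch) : k < j := by
  by_contra hle
  have := (x.state_extends r (not_lt.1 hle)).epoch
  omega

/-- Between states of different epochs there is a step in which all blocks are globally
confirmed. -/
theorem exists_confirmed_of_epoch_lt {r : P.Replica} {k k' : ℕ}
    (h : (x.state r k).epoch < (x.state r k').epoch) :
    ∃ j ≥ k, ∀ i, ∀ B ∈ (x.state r j).gin i, B ∈ (x.state r j).gout := by
  have hk := (lt_of_epoch_lt h).le
  induction k', hk using Nat.le_induction with
  | base => exact absurd h (lt_irrefl _)
  | succ j hj ih =>
    by_cases he : (x.state r (j + 1)).epoch = (x.state r j).epoch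
    · exact ih (he ▸ h)
    · obtain h' | ⟨inp, -, h'⟩ := x.state_succ_cases j r
      · exact absurd (congrArg LState.epoch h') he
      · rw [h'] at he
        exact ⟨j + 1, by omega, h' ▸ (step_of_epoch_ne he).2.2.2⟩

/-- Epochs are entered one after the other, and at their beginning. -/
theorem exists_fresh_of_le_epoch {r : P.Replica} {e k : ℕ} (h : e ≤ (x.state r k).epoch) :
    ∃ j, (x.state r j).epoch = e ∧ (x.state r j).Fresh := by
  induction k with
  | zero => exact ⟨0, (Nat.le_zero.1 h).symm, LState.init_fresh⟩
  | succ k ih =>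
    by_cases hk : e ≤ (x.state r k).epoch
    · exact ih hk
    · obtain h' | ⟨inp, -, h'⟩ := x.state_succ_cases k r
      · exact absurd (h' ▸ h) hk
      · have hne : (step r (x.state r k) inp).1.epoch ≠ (x.state r k).epoch := by
          rw [← h']; omega
        obtain ⟨h1, h2, -⟩ := step_of_epoch_ne hne
        rw [← h'] at h1 h2
        exact ⟨k + 1, by omega, h2⟩

theorem Delivers.state_succ {k : ℕ} {r : P.Replica} {s : Slot P} {msg : Option (Proposal P)}
    (h : x.Delivers k r s msg) :
    x.state r (k + 1) = (step r (x.state r k) (.deliver s msg)).1 :=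
  state_succ_of_event h.1

/-- The checkpoint messages of all epochs that a replica has left have been sent, and so has that
of the current epoch if the replica has finished it. -/
theorem sends_checkpoint_invariant (x : Execution P) (r : P.Replica) (k : ℕ) :
    (∀ e < (x.state r k).epoch, ∃ j, x.Sends j r (.checkpoint e)) ∧
    ((x.state r k).ckptSent = true → ∃ j, x.Sends j r (.checkpoint (x.state r k).epoch)) ∧
    (EpochDone (x.state r k) → (x.state r k).ckptSent = true) := by
  induction k with
  | zero =>
    exact ⟨fun e he => absurd he (Nat.not_lt_zero e),
      fun h => absurd h (by simp [state, LState.init]),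
      fun h => absurd h LState.init_fresh.not_epochDone⟩
  | succ k ih =>
    obtain h | ⟨inp, hev, h⟩ := x.state_succ_cases k r
    · rwa [h]
    rw [h]
    have hsent : EpochDone (handle r (x.state r k) inp).1 →
        ∃ j, x.Sends j r (.checkpoint (x.state r k).epoch) := by
      intro hd
      cases hs : (x.state r k).ckptSent with
      | true => exact ih.2.1 hs
      | false => exact ⟨k, inp, hev, Output.checkpoint_mem_step hd hs⟩
    obtain ⟨hd, _, _, -, heq⟩ | ⟨-, _, sent, h1, h2, heq⟩ := step_cases r (x.state r k) inp <;>
      rw [heq]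
    · refine ⟨fun e he => ?_, fun hf => absurd hf (by simp), fun hf => ?_⟩
      · simp only [handle_epoch] at he
        rcases Nat.lt_succ_iff_lt_or_eq.1 he with he | rfl
        · exact ih.1 e he
        · exact hsent hd
      · exact absurd (hf.1 ⟨0, P.m_pos⟩) (by simp)
    · refine ⟨fun e he => ih.1 e (by simpa [handle_epoch] using he), fun hs => ?_, h1⟩
      simp only [handle_epoch]
      rcases h2 hs with hd | hs
      · exact hsent hd
      · exact ih.2.1 (by rwa [handle_ckptSent] at hs)

variable {Byz : Finset P.Replica}

theorem IsExecution.valid_of_delivers (hx : x.IsExecution {r | r ∉ Byz}) {k : ℕ}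
    {r : P.Replica} (hr : r ∉ Byz) {s : Slot P} {p : Proposal P}
    (h : x.Delivers k r s (some p)) : p.Valid s :=
  (hx.broadcast s.epoch s.index s.view).allowed_of_deliver k r hr p s.round h

theorem IsExecution.logInv (hx : x.IsExecution {r | r ∉ Byz}) {r : P.Replica} (hr : r ∉ Byz)
    (k : ℕ) : (x.state r k).LogInv := by
  induction k with
  | zero =>
    refine ⟨fun i B hB => ?_, fun i hf => ?_, fun _ i B hB => ?_⟩
    · simp [state, LState.init] at hB
    · simp [state, LState.init] at hf
    · simp [state, LState.init] at hB
  | succ k ih =>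
    obtain h | ⟨inp, hev, h⟩ := x.state_succ_cases k r <;> rw [h]
    · exact ih
    · refine step_logInv (handle_logInv ih fun s p hi hs => ?_)
      exact (hx.valid_of_delivers hr ⟨hi ▸ hev, hs⟩).rank_le

/-- The invariant on rounds, together with the same bound for the reports of honest replicas. Each
of the two at later steps rests on the other one at earlier steps. -/
theorem IsExecution.roundInv_and_reports (hx : x.IsExecution {r | r ∉ Byz})
    (hByz : Byz.card ≤ P.f) (k : ℕ) :
    (∀ r ∉ Byz, (x.state r k).RoundInv) ∧
    ∀ j < k, ∀ r ∉ Byz, ∀ dst μ, x.Sends j r (.rank dst μ) → μ.round + 1 ≤ μ.rank + 2 := by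
  induction k with
  | zero =>
    refine ⟨fun r _ i _ => ?_, fun j hj => absurd hj (Nat.not_lt_zero j)⟩
    constructor <;> simp [state, LState.init]
  | succ k ih =>
    have hhandle : ∀ r ∉ Byz, ∀ inp, x.event k = some (r, inp) →
        (handle r (x.state r k) inp).1.RoundInv := by
      intro r hr inp hev
      refine handle_roundInv (ih.1 r hr) fun s p hi hs => ?_
      have hd : x.Delivers k r s (some p) := ⟨hi ▸ hev, hs⟩
      have hv := hx.valid_of_delivers hr hd
      refine ⟨hv.rank_le, hv.round_le_rank hByz fun μ hμ hsend => ?_⟩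
      obtain ⟨j, hj, dst, hS⟩ := hx.unforgeable.2.2 k r hr s p hd μ hμ hsend
      exact ih.2 j hj _ hsend dst μ hS
    refine ⟨fun r hr => ?_, fun j hj r hr dst μ hS => ?_⟩
    · obtain h | ⟨inp, hev, h⟩ := x.state_succ_cases k r <;> rw [h]
      · exact ih.1 r hr
      · exact step_roundInv (hhandle r hr inp hev)
    · rcases Nat.lt_succ_iff_lt_or_eq.1 hj with hj | rfl
      · exact ih.2 j hj r hr dst μ hS
      obtain ⟨inp, hev, hmem⟩ := hS
      obtain ⟨τ, i, hτ, hf, rfl⟩ := Output.rank_mem_step hmem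
      have hinv : τ.RoundInv := by
        rcases hτ with rfl | rfl
        · exact hhandle r hr inp hev
        · exact step_roundInv (hhandle r hr inp hev)
      have := (hinv i hf).1
      simp only [ownRankMsg]
      omega

/-- From some step on, failure detectors of honest replicas do not suspect honest replicas. -/
theorem IsExecution.exists_accurate (hx : x.IsExecution {r | r ∉ Byz}) :
    ∃ K, ∀ k ≥ K, ∀ q ∉ Byz, ∀ p ∉ Byz, ¬ x.suspects k q p := by
  obtain ⟨T, hT⟩ := hx.detector
  obtain ⟨K, hK⟩ := Filter.eventually_atTop.1 (hx.clock.2.eventually_ge_atTop T)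
  exact ⟨K, fun k hk q hq p hp => hT k (hK k hk) q hq p hp⟩

/-! ### Progress within an epoch -/

/-- All honest replicas run slot `s` at some time. -/
def AllRun (x : Execution P) (Byz : Finset P.Replica) (s : Slot P) : Prop :=
  ∀ q ∉ Byz, ∃ k, (x.state q k).Runs s

/-- By Termination and Agreement, a slot that all honest replicas run has a common outcome. -/
theorem IsExecution.exists_delivers (hx : x.IsExecution {r | r ∉ Byz}) {s : Slot P}
    (h : x.AllRun Byz s) : ∃ msg, ∀ q ∉ Byz, ∃ k, x.Delivers k q s msg := by
  have hsb := hx.broadcast s.epoch s.index s.view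
  by_cases hH : ∃ q, q ∉ Byz
  · obtain ⟨q, hq⟩ := hH
    obtain ⟨k, msg, hd⟩ := hsb.termination q hq s.round h
    refine ⟨msg, fun q' hq' => ?_⟩
    obtain ⟨k', msg', hd'⟩ := hsb.termination q' hq' s.round h
    rw [hsb.agreement k k' q hq q' hq' _ _ _ hd hd']
    exact ⟨k', hd'⟩
  · exact ⟨none, fun q hq => absurd ⟨q, hq⟩ hH⟩

theorem AllRun.viewChange {s : Slot P} (h : ∀ q ∉ Byz, ∃ k, x.Delivers k q s none) :
    x.AllRun Byz ⟨s.epoch, s.index, s.view + 1, s.round⟩ := by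
  intro q hq
  obtain ⟨k, hd⟩ := h q hq
  exact ⟨k + 1, hd.state_succ ▸ step_runs_of_nil hd.2⟩

theorem AllRun.commit {s : Slot P} {p : Proposal P}
    (h : ∀ q ∉ Byz, ∃ k, x.Delivers k q s (some p)) (hp : p.block.rank ≠ P.maxRank s.epoch) :
    x.AllRun Byz ⟨s.epoch, s.index, s.view, s.round + 1⟩ := by
  intro q hq
  obtain ⟨k, hd⟩ := h q hq
  exact ⟨k + 1, hd.state_succ ▸ step_runs_of_commit hd.2 hp⟩

/-- Honest leaders of late views are not demoted. -/
theorem IsExecution.exists_view_bound (hx : x.IsExecution {r | r ∉ Byz}) (i : Fin P.m) :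
    ∃ V, ∀ s : Slot P, s.index = i → V ≤ s.view → s.leader ∉ Byz →
      ∀ k, ∀ q ∉ Byz, ¬ x.Delivers k q s none := by
  obtain ⟨K, hK⟩ := hx.exists_accurate
  -- `V` exceeds all views that are run before failure detectors have become accurate.
  let F : ℕ × P.Replica → ℕ := fun a => (x.state a.2 a.1).view i
  refine ⟨(Finset.range K ×ˢ Finset.univ).sup F + 1, fun s hi hV hl k q hq hd => ?_⟩
  subst hi
  obtain ⟨j, -, q', hq', hrun, hsus⟩ :=
    (hx.broadcast s.epoch s.index s.view).nil_of_suspicion k q hq s.round hd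
  by_cases hj : j < K
  · have h1 : F (j, q') ≤ _ := Finset.le_sup (f := F)
      (Finset.mem_product.2 ⟨Finset.mem_range.2 hj, Finset.mem_univ q'⟩)
    have h2 : F (j, q') = s.view := congrArg Slot.view hrun.1
    omega
  · exact hK j (not_lt.1 hj) q' hq' _ hl hsus

/-- In an epoch that all honest replicas enter, all of them commit a block of the maximal rank in
every instance: rounds are bounded by `maxRank`, and views by the first honest leader who is
never suspected, while every outcome but a block of the maximal rank increases one of the two. -/
theorem IsExecution.exists_last_block (hx : x.IsExecution {r | r ∉ Byz})
    (hByz : Byz.card ≤ P.f) {e : ℕ} {i : Fin P.m} (h : x.AllRun Byz ⟨e, i, 0, 1⟩) :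
    ∃ s : Slot P, s.epoch = e ∧ s.index = i ∧ ∃ p : Proposal P,
      p.block.rank = P.maxRank e ∧ ∀ q ∉ Byz, ∃ k, x.Delivers k q s (some p) := by
  obtain ⟨V, hV⟩ := hx.exists_view_bound i
  obtain ⟨v', hv', hlead⟩ := P.exists_honest_leader_ge Byz hByz i V
  obtain ⟨q₀, hq₀⟩ : ∃ q, q ∉ Byz := ⟨_, hlead⟩
  have main : ∀ N v n, v ≤ v' → (v' - v) + (P.maxRank e + 1 - n) = N →
      x.AllRun Byz ⟨e, i, v, n⟩ →
      ∃ s : Slot P, s.epoch = e ∧ s.index = i ∧ ∃ p : Proposal P,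
        p.block.rank = P.maxRank e ∧ ∀ q ∉ Byz, ∃ k, x.Delivers k q s (some p) := by
    intro N
    induction N using Nat.strong_induction_on with
    | _ N ih =>
      intro v n hv hN hrun
      obtain ⟨msg, hmsg⟩ := hx.exists_delivers hrun
      cases msg with
      | none =>
        have hne : v ≠ v' := by
          rintro rfl
          obtain ⟨k, hd⟩ := hmsg q₀ hq₀
          exact hV ⟨e, i, v, n⟩ rfl hv' hlead k q₀ hq₀ hd
        exact ih _ (by omega) (v + 1) n (by omega) rfl (AllRun.viewChange hmsg)
      | some p =>
        by_cases hp : p.block.rank = P.maxRank e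
        · exact ⟨_, rfl, rfl, p, hp, hmsg⟩
        have hnext := AllRun.commit hmsg hp
        have hn : n + 1 ≤ P.maxRank e + 1 := by
          obtain ⟨k, hk⟩ := hnext q₀ hq₀
          have h1 := ((hx.roundInv_and_reports hByz k).1 q₀ hq₀ i hk.2).2
          have h2 : (x.state q₀ k).epoch = e := congrArg Slot.epoch hk.1
          have h3 : (x.state q₀ k).round i = n + 1 := congrArg Slot.round hk.1
          rwa [h2, h3] at h1
        exact ih _ (by omega) v (n + 1) hv rfl hnext
  exact main _ 0 1 (Nat.zero_le _) rfl h

/-- In an epoch that all honest replicas enter, each of them finishes all instances. -/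
theorem IsExecution.exists_all_finished (hx : x.IsExecution {r | r ∉ Byz})
    (hByz : Byz.card ≤ P.f) {e : ℕ} (h : ∀ i, x.AllRun Byz ⟨e, i, 0, 1⟩)
    {q : P.Replica} (hq : q ∉ Byz) :
    ∃ k, e < (x.state q k).epoch ∨
      ((x.state q k).epoch = e ∧ ∀ i, (x.state q k).finished i = true) := by
  have h1 : ∀ i, ∃ k, e < (x.state q k).epoch ∨
      ((x.state q k).epoch = e ∧ (x.state q k).finished i = true) := by
    intro i
    obtain ⟨s, rfl, rfl, p, hp, hall⟩ := hx.exists_last_block hByz (h i)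
    obtain ⟨k, hd⟩ := hall q hq
    refine ⟨k + 1, ?_⟩
    have hle := (x.state_extends q (Nat.le_succ k)).epoch
    rw [show (x.state q k).epoch = s.epoch from congrArg Slot.epoch hd.2.1] at hle
    rcases hle.lt_or_eq with hlt | heq
    · exact Or.inl hlt
    · refine Or.inr ⟨heq.symm, ?_⟩
      rw [Nat.succ_eq_add_one, hd.state_succ] at heq
      rw [hd.state_succ]
      exact step_finished_of_commit hd.2 hp heq.symm
  choose κ hκ using h1
  have hle : ∀ i, κ i ≤ Finset.univ.sup κ := fun i => Finset.le_sup (Finset.mem_univ i)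
  refine ⟨Finset.univ.sup κ, ?_⟩
  have hmono : ∀ i, (x.state q (κ i)).Extends (x.state q (Finset.univ.sup κ)) :=
    fun i => x.state_extends q (hle i)
  generalize x.state q (Finset.univ.sup κ) = σ at hmono ⊢
  rcases lt_or_ge e σ.epoch with hlt | hge
  · exact Or.inl hlt
  have hfin : ∀ i, σ.epoch = e ∧ σ.finished i = true := by
    intro i
    have hE := (hmono i).epoch
    rcases hκ i with h | ⟨h, hf⟩
    · omega
    · have he : σ.epoch = e := by omega
      exact ⟨he, (hmono i).finished (by omega) i hf⟩
  exact Or.inr ⟨(hfin ⟨0, P.m_pos⟩).1, fun i => (hfin i).2⟩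

theorem IsExecution.exists_sends_checkpoint (hx : x.IsExecution {r | r ∉ Byz})
    (hByz : Byz.card ≤ P.f) {e : ℕ} (h : ∀ i, x.AllRun Byz ⟨e, i, 0, 1⟩)
    {q : P.Replica} (hq : q ∉ Byz) : ∃ j, x.Sends j q (.checkpoint e) := by
  obtain ⟨k, hk⟩ := hx.exists_all_finished hByz h hq
  obtain ⟨h1, h2, h3⟩ := x.sends_checkpoint_invariant q k
  rcases hk with hlt | ⟨rfl, hf⟩
  · exact h1 e hlt
  · exact h2 (h3 ((hx.logInv hq k).epochDone hf))

theorem IsExecution.exists_stableCheckpoint (hx : x.IsExecution {r | r ∉ Byz})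
    (hByz : Byz.card ≤ P.f) {e : ℕ} (h : ∀ i, x.AllRun Byz ⟨e, i, 0, 1⟩)
    {r : P.Replica} (hr : r ∉ Byz) :
    ∃ K, ∀ k ≥ K, (x.state r k).epoch = e → StableCheckpoint (x.state r k) := by
  obtain ⟨GST, hlinks⟩ := hx.links
  have h1 : ∀ q, ∃ k, q ∉ Byz → (q, e) ∈ (x.state r k).checkpoints := by
    intro q
    by_cases hq : q ∈ Byz
    · exact ⟨0, fun h => absurd hq h⟩
    obtain ⟨j, hj⟩ := hx.exists_sends_checkpoint hByz h hq
    obtain ⟨j', -, -, hev⟩ := (hlinks j q hq r hr).2 e hj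
    exact ⟨j' + 1, fun _ => by rw [state_succ_of_event hev]; exact mem_checkpoints_step _ _ _ _⟩
  choose κ hκ using h1
  refine ⟨Finset.univ.sup κ, fun k hk he => ?_⟩
  have hsub : Finset.univ \ Byz ⊆
      Finset.univ.filter fun q : P.Replica => (q, e) ∈ (x.state r k).checkpoints := by
    intro q hq
    have hq' : q ∉ Byz := (Finset.mem_sdiff.1 hq).2
    have hle : κ q ≤ k := (Finset.le_sup (f := κ) (Finset.mem_univ q)).trans hk
    exact Finset.mem_filter.2 ⟨Finset.mem_univ q,
      (x.state_extends r hle).checkpoints (hκ q hq')⟩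
  have hcard := Finset.card_le_card hsub
  have hdiff := Finset.le_card_sdiff Byz (Finset.univ : Finset P.Replica)
  rw [Finset.card_univ, Fintype.card_fin] at hdiff
  rw [StableCheckpoint, he]
  omega

/-- An epoch that all honest replicas enter is also left by all of them. -/
theorem IsExecution.exists_epoch_gt (hx : x.IsExecution {r | r ∉ Byz})
    (hByz : Byz.card ≤ P.f) {e : ℕ} (h : ∀ i, x.AllRun Byz ⟨e, i, 0, 1⟩)
    {r : P.Replica} (hr : r ∉ Byz) : ∃ k, e < (x.state r k).epoch := by
  obtain ⟨k, hlt | ⟨he, hf⟩⟩ := hx.exists_all_finished hByz h hr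
  · exact ⟨k, hlt⟩
  obtain ⟨K, hK⟩ := hx.exists_stableCheckpoint hByz h hr
  -- The first step without input after both conditions have been met ends the epoch.
  obtain ⟨j, hj, hev⟩ := hx.active r hr (max k K)
  have hext := x.state_extends r ((le_max_left k K).trans hj)
  by_contra! hle
  have hej : (x.state r j).epoch = e := le_antisymm (hle j) (he ▸ hext.epoch)
  have hd : EpochDone (x.state r j) :=
    (hx.logInv hr j).epochDone fun i => hext.finished (he.trans hej.symm) i (hf i)
  have hs := hK j ((le_max_right k K).trans hj) hej
  obtain ⟨-, _, _, -, heq⟩ | ⟨hn, -⟩ := step_cases r (x.state r j) .wake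
  · have h1 := hle (j + 1)
    rw [state_succ_of_event hev, heq] at h1
    simp only [handle_epoch] at h1
    omega
  · exact hn ⟨hd, hs⟩

theorem IsExecution.exists_fresh (hx : x.IsExecution {r | r ∉ Byz})
    (hByz : Byz.card ≤ P.f) (e : ℕ) {r : P.Replica} (hr : r ∉ Byz) :
    ∃ k, (x.state r k).epoch = e ∧ (x.state r k).Fresh := by
  induction e generalizing r with
  | zero => exact ⟨0, rfl, LState.init_fresh⟩
  | succ e ih =>
    have hall : ∀ i, x.AllRun Byz ⟨e, i, 0, 1⟩ := by
      intro i q hq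
      obtain ⟨k, rfl, hk⟩ := ih hq
      exact ⟨k, hk i⟩
    obtain ⟨k, hk⟩ := hx.exists_epoch_gt hByz hall hr
    exact exists_fresh_of_le_epoch hk

theorem IsExecution.allRun (hx : x.IsExecution {r | r ∉ Byz})
    (hByz : Byz.card ≤ P.f) (e : ℕ) (i : Fin P.m) : x.AllRun Byz ⟨e, i, 0, 1⟩ := by
  intro q hq
  obtain ⟨k, rfl, hk⟩ := hx.exists_fresh hByz e hq
  exact ⟨k, hk i⟩

/-- Every partially committed block is eventually globally confirmed, since its epoch ends. -/
theorem IsExecution.exists_mem_gout (hx : x.IsExecution {r | r ∉ Byz})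
    (hByz : Byz.card ≤ P.f) {r : P.Replica} (hr : r ∉ Byz) {k : ℕ} {i : Fin P.m}
    {B : Block P} (hB : B ∈ (x.state r k).gin i) (k₀ : ℕ) :
    ∃ j ≥ k₀, B ∈ (x.state r j).gout := by
  obtain ⟨k', he, -⟩ := hx.exists_fresh hByz ((x.state r k).epoch + 1) hr
  obtain ⟨j, hj, hconf⟩ :=
    exists_confirmed_of_epoch_lt (x := x) (r := r) (k := k) (k' := k') (by omega)
  exact ⟨max j k₀, le_max_right _ _, (x.state_extends r (le_max_left j k₀)).gout
    (hconf i B ((x.state_extends r hj).gin i hB))⟩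

/-! ### Transactions are committed -/

/-- Let the first leader of instance `i` be honest, and let `pre` be what its pool holds before
`tx`. If `tx` is never committed there, then an uncommitted transaction of `pre` is committed later:
by the first block of the instance in a later epoch in which the instance has the bucket of
`tx`. -/
theorem IsExecution.exists_commit (hx : x.IsExecution {r | r ∉ Byz})
    (hByz : Byz.card ≤ P.f) {i : Fin P.m} (hi : P.leader i 0 ∉ Byz) {K k : ℕ} (hk : K ≤ k)
    (hK : ∀ k ≥ K, ∀ q ∉ Byz, ∀ p ∉ Byz, ¬ x.suspects k q p)
    {tx : Tx} {pre post : List Tx}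
    (hpool : (x.state (P.leader i 0) k).pool = pre ++ tx :: post)
    (hnew : ∀ j i', ∀ B ∈ (x.state (P.leader i 0) j).gin i', tx ∉ B.txs) :
    ∃ k' ≥ k, ∃ t ∈ pre, (∀ i', ∀ B ∈ (x.state (P.leader i 0) k).gin i', t ∉ B.txs) ∧
      ∃ i', ∃ B ∈ (x.state (P.leader i 0) k').gin i', t ∈ B.txs := by
  set p := P.leader i 0
  obtain ⟨e, he, hbucket⟩ := exists_ge_add_mod_eq (P.bucketOf tx).val
    (Finset.univ.sup (fun q => (x.state q k).epoch) + 1) i.isLt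
  have hepoch : ∀ q, (x.state q k).epoch < e := fun q =>
    lt_of_lt_of_le (Nat.lt_succ_of_le
      (Finset.le_sup (f := fun q => (x.state q k).epoch) (Finset.mem_univ q))) he
  have hlate : ∀ q j, (x.state q j).epoch = e → k < j := fun q j hj =>
    lt_of_epoch_lt (hj ▸ hepoch q)
  obtain ⟨msg, hmsg⟩ := hx.exists_delivers (hx.allRun hByz e i)
  obtain ⟨j, hd⟩ := hmsg p hi
  have hsb := hx.broadcast e i 0
  have hkj : k < j := hlate p j (congrArg Slot.epoch hd.2.1)
  cases msg with
  | none =>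
    obtain ⟨j', -, q, hq, hrun, hsus⟩ := hsb.nil_of_suspicion j p hi 1 hd
    have := hlate q j' (congrArg Slot.epoch hrun.1)
    exact absurd hsus (hK j' (by omega) q hq p hi)
  | some pr =>
    obtain ⟨j₁, hj₁, inp, hev, hout⟩ := hsb.integrity j p hi pr 1 hd hi
    have hout' : Output.propose ⟨e, i, 0, 1⟩ pr ∈ (step p (x.state p j₁) inp).2 := hout
    obtain ⟨hslot, htxs⟩ := Output.propose_mem_step hout'
    have hev' : x.event j₁ = some (p, inp) := hev
    rw [← state_succ_of_event hev'] at hslot htxs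
    have he₁ : e = (x.state p (j₁ + 1)).epoch := congrArg Slot.epoch hslot
    have hext := x.state_extends p (hlate p (j₁ + 1) he₁.symm).le
    obtain ⟨post', hpost⟩ := hext.pool
    rw [hpool, List.append_assoc, List.cons_append] at hpost
    obtain ⟨t, ht, htpre, htnew⟩ := exists_mem_cutBatch hpost.symm
      (show P.InBucketSet _ i tx from he₁ ▸ hbucket) (hnew (j₁ + 1))
    have hB : pr.block ∈ (x.state p (j + 1)).gin i := by
      rw [hd.state_succ]; exact step_mem_gin_of_commit hd.2
    have htB : t ∈ pr.block.txs := htxs ▸ ht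
    rcases htpre with htpre | rfl
    · exact ⟨j + 1, by omega, t, htpre,
        fun i' B hB' => htnew i' B (hext.gin i' hB'), i, pr.block, hB, htB⟩
    · exact absurd htB (hnew (j + 1) i _ hB)

/-- A transaction that honest replicas receive is partially committed by one of them. -/
theorem IsExecution.exists_mem_gin (hx : x.IsExecution {r | r ∉ Byz})
    (hByz : Byz.card ≤ P.f) {tx : Tx} (hpool : ∀ r ∉ Byz, ∃ k, tx ∈ (x.state r k).pool) :
    ∃ r, r ∉ Byz ∧ ∃ k i, ∃ B ∈ (x.state r k).gin i, tx ∈ B.txs := by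
  classical
  by_contra! hnew
  obtain ⟨i, hi⟩ := P.exists_honest_first_leader Byz hByz
  obtain ⟨K₁, hK₁⟩ := hx.exists_accurate
  obtain ⟨K₂, hK₂⟩ := hpool _ hi
  have hK₃ := (x.state_extends (P.leader i 0) (le_max_right K₁ K₂)).pool.subset hK₂
  obtain ⟨pre, post, hpre⟩ := List.append_of_mem hK₃
  -- The number of uncommitted transactions older than `tx` would decrease forever.
  let U : ℕ → Finset Tx := fun k => pre.toFinset.filter fun t =>
    ∀ i', ∀ B ∈ (x.state (P.leader i 0) k).gin i', t ∉ B.txs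
  have hdec : ∀ k ≥ max K₁ K₂, ∃ k' ≥ k, (U k').card < (U k).card := by
    intro k hk
    obtain ⟨post', hpost⟩ := (x.state_extends (P.leader i 0) hk).pool
    rw [hpre, List.append_assoc, List.cons_append] at hpost
    obtain ⟨k', hk', t, ht, h1, i', B, hB, htB⟩ := hx.exists_commit hByz hi
      ((le_max_left _ _).trans hk) hK₁ hpost.symm (hnew _ hi)
    refine ⟨k', hk', Finset.card_lt_card (Finset.ssubset_iff_subset_ne.2 ⟨?_, ?_⟩)⟩
    · exact Finset.monotone_filter_right _ fun u _ hu i' B hB =>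
        hu i' B ((x.state_extends _ hk').gin i' hB)
    · intro heq
      have : t ∈ U k' := heq ▸ Finset.mem_filter.2 ⟨List.mem_toFinset.2 ht, h1⟩
      exact (Finset.mem_filter.1 this).2 i' B hB htB
  have hinf : ∀ N, ∃ k ≥ max K₁ K₂, (U k).card + N ≤ (U (max K₁ K₂)).card := by
    intro N
    induction N with
    | zero => exact ⟨_, le_rfl, le_rfl⟩
    | succ N ih =>
      obtain ⟨k, hk, hN⟩ := ih
      obtain ⟨k', hk', hlt⟩ := hdec k hk
      exact ⟨k', hk.trans hk', by omega⟩
  obtain ⟨k, -, hk⟩ := hinf ((U (max K₁ K₂)).card + 1)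
  omega

end Execution

end Ladon

theorem mainTheorem3 {Tx : Type*} [DecidableEq Tx] (P : Ladon.Params Tx)
    (Byz : Finset P.Replica) (hByz : Byz.card ≤ P.f)
    (x : Ladon.Execution P) (hx : x.IsExecution {r | r ∉ Byz})
    (k : ℕ) (tx : Tx) (htx : x.clientBroadcast k tx) :
    ∃ r, r ∉ Byz ∧ ∃ j ≥ k, ∃ B ∈ (x.state r j).gout, tx ∈ B.txs := by
  have hpool : ∀ r ∉ Byz, ∃ j, tx ∈ (x.state r j).pool := by
    intro r hr
    obtain ⟨j, -, hev⟩ := hx.clients k tx htx r hr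
    refine ⟨j + 1, ?_⟩
    rw [Ladon.Execution.state_succ_of_event hev]
    exact Ladon.mem_pool_step _ _ _
  obtain ⟨r, hr, k', i, B, hB, htB⟩ := hx.exists_mem_gin hByz hpool
  obtain ⟨j, hj, hout⟩ := hx.exists_mem_gout hByz hr hB k
  exact ⟨r, hr, j, hj, B, hout, htB⟩
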